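/- Consider classical propositional linear logic LL over an arbitrary set of atoms, with constants $1,\bot,\top,0$ and connectives $(-)^\bot,\otimes,⅋,\&,\oplus,!,?$, given by the usual two-sided sequent calculus with cut. For an interpretation of the constants and connectives as objects and operations on objects of a category $\mathcal D$, every valuation $v$ of the atoms by objects of $\mathcal D$ extends to an interpretation $[\![\varphi]\!]_v$ of formulas. A formula $\varphi$ is *validated* if $\hom(1,[\![\varphi]\!]_v)\neq\varnothing$ for all $v$; the interpretation is *sound* (*complete*) for LL if, for all formulas $\varphi,\psi$, derivability of $\varphi\vdash\psi$ in LL implies (is implied by) the condition that $\hom([\![\varphi]\!]_v,[\![\psi]\!]_v)\neq\varnothing$ for all $v$. (1) The formula $\bot\otimes\top$ is not provable in LL. (2) Let $\mathcal R$ be a model of multiplicative exponential linear logic, that is, a symmetric monoidal adjunction $L\dashv M:R\to S$ between a $*$-autonomous category $R$ and a category $S$ with finite products, with $!A=LMA$ and $?A=(!A^\bot)^\bot$. Its dialectica category $\mathfrak D_l(R)$ has as objects the families $\mathcal G^X_Y=(\mathcal G^x_y)_{x\in X,y\in Y}$ of objects of $R$, where $X,Y$ are sets that are not both empty; a morphism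 $\mathcal G^X_Y\to\mathcal H^U_V$ is a triple of maps $f:X\to U$, $g:V\to Y$ and a family of morphisms $\mathcal G^x_{gv}\to\mathcal H^{fx}_v$ of $R$ $(x\in X,v\in V)$. LL is interpreted in it by - $1$ and $\bot$: the families with $X=Y=\{*\}$ and value $1$, respectively $\bot=1^\bot$; - $\top$: $X=\{*\}$, $Y=\varnothing$; $\;0$: $X=\varnothing$, $Y=\{*\}$; - $(\mathcal G^X_Y)^\bot$: index sets $Y$ and $X$, value $(\mathcal G^x_y)^\bot$ at $\binom{y}{x}$; - $\mathcal G^X_Y\otimes\mathcal H^U_V$: index sets $X\times U$ and $(U\to Y)\times(X\to V)$, value $\mathcal G^x_{fu}\otimes\mathcal H^u_{gx}$ at $\binom{x,u}{f,g}$; dually $\mathcal G^X_Y⅋\mathcal H^U_V$: index sets $(V\to X)\times(Y\to U)$ and $Y\times V$, value $\mathcal G^{fv}_y⅋\mathcal H^{gy}_v$ at $\binom{f,g}{y,v}$; - $\mathcal G^X_Y\&\mathcal H^U_V$: index sets $X\times U$ and $Y+V$, value $\mathcal G^x_z$ for $z\in Y$ and $\mathcal H^u_z$ for $z\in V$; dually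 $\mathcal G^X_Y\oplus\mathcal H^U_V$: index sets $X+U$ and $Y\times V$, value $\mathcal G^z_y$ for $z\in X$ and $\mathcal H^z_v$ for $z\in U$; - $!\mathcal G^X_Y$: index sets $X$ and $X\to Y^*$ ($Y^*$ the set of finite multisets in $Y$), value $\bigotimes_{y\in fx}!\mathcal G^x_y$ at $\binom{x}{f}$; dually $?\mathcal G^X_Y$: index sets $Y\to X^*$ and $Y$, value $⅋_{x\in gy}?\mathcal G^x_y$ at $\binom{g}{y}$. Then $\bot\otimes\top\cong\top$ in $\mathfrak D_l(R)$, the formula $\bot\otimes\top$ is validated, and the interpretation is not complete for LL; in particular it is not both sound and complete. (3) The same holds over any cartesian closed base. Let $\mathcal C$ be a cartesian closed category with finite coproducts, and let $E$ be an indexed $*$-autonomous category over $\mathcal C$ (a pseudofunctor on $\mathcal C^{op}$ with $*$-autonomous fibres and reindexing functors preserving $\otimes$, $1$ and $(-)^\bot$) such that $E(0)$ is equivalent to the terminal category for every initial object $0$ and $E(A+B)\simeq E(A)\times E(B)$ by restriction. Its dialectica category has as objects triples $(X,Y,G)$ with $X,Y\in\mathcal C$ and $G\in E(X\times Y)$;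 a morphism $(X,Y,G)\to(U,V,H)$ consists of $f:X\to U$, $g:V\to Y$ and a morphism $(X\times g)^*G\to(f\times V)^*H$ in $E(X\times V)$; the constants and the connectives other than $!,?$ are interpreted by the formulas of (2) read in $\mathcal C$ and $E$. Then $\bot\otimes\top\cong\top$ and, whatever operation on objects interprets $!$ (with $?G=(!G^\bot)^\bot$), the formula $\bot\otimes\top$ is validated and the interpretation is not complete for LL; in particular it is not both sound and complete. Hence no dialectica category is both sound and complete for classical linear logic. -/

import Mathlib

open CategoryTheory MonoidalCategory CartesianMonoidalCategory Limits

universe w v u v' u' a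

/-! ## Propositional classical linear logic -/

/-- Formulas of full propositional classical linear logic over a type of atoms; linear implication
`φ ⊸ ψ` is the usual abbreviation for `φ^⊥ ⅋ ψ`. -/
inductive LLFormula (Atom : Type a) : Type a
  | atom (p : Atom) : LLFormula Atom
  | neg (φ : LLFormula Atom) : LLFormula Atom
  | one : LLFormula Atom
  | bot : LLFormula Atom
  | tensor (φ ψ : LLFormula Atom) : LLFormula Atom
  | par (φ ψ : LLFormula Atom) : LLFormula Atom
  | top : LLFormula Atom
  | zero : LLFormula Atom
  | and (φ ψ : LLFormula Atom) : LLFormula Atom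
  | plus (φ ψ : LLFormula Atom) : LLFormula Atom
  | bang (φ : LLFormula Atom) : LLFormula Atom
  | whynot (φ : LLFormula Atom) : LLFormula Atom

namespace LLFormula

/-- The two-sided sequent calculus of classical linear logic, with cut. Sequents `Γ ⊢ Δ` are pairs
of finite multisets of formulas, so the exchange rules are built in. -/
inductive Derivable {Atom : Type a} :
    Multiset (LLFormula Atom) → Multiset (LLFormula Atom) → Prop
  | ax (φ) : Derivable {φ} {φ}
  | cut {Γ Γ' Δ Δ'} (φ) :
      Derivable Γ (φ ::ₘ Δ) → Derivable (φ ::ₘ Γ') Δ' → Derivable (Γ + Γ') (Δ + Δ')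
  | negL {Γ Δ φ} : Derivable Γ (φ ::ₘ Δ) → Derivable (neg φ ::ₘ Γ) Δ
  | negR {Γ Δ φ} : Derivable (φ ::ₘ Γ) Δ → Derivable Γ (neg φ ::ₘ Δ)
  | oneL {Γ Δ} : Derivable Γ Δ → Derivable (one ::ₘ Γ) Δ
  | oneR : Derivable 0 {one}
  | botL : Derivable {bot} 0
  | botR {Γ Δ} : Derivable Γ Δ → Derivable Γ (bot ::ₘ Δ)
  | tensorL {Γ Δ φ ψ} : Derivable (φ ::ₘ ψ ::ₘ Γ) Δ → Derivable (tensor φ ψ ::ₘ Γ) Δ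
  | tensorR {Γ Γ' Δ Δ' φ ψ} : Derivable Γ (φ ::ₘ Δ) → Derivable Γ' (ψ ::ₘ Δ') →
      Derivable (Γ + Γ') (tensor φ ψ ::ₘ (Δ + Δ'))
  | parL {Γ Γ' Δ Δ' φ ψ} : Derivable (φ ::ₘ Γ) Δ → Derivable (ψ ::ₘ Γ') Δ' →
      Derivable (par φ ψ ::ₘ (Γ + Γ')) (Δ + Δ')
  | parR {Γ Δ φ ψ} : Derivable Γ (φ ::ₘ ψ ::ₘ Δ) → Derivable Γ (par φ ψ ::ₘ Δ)
  | topR (Γ Δ) : Derivable Γ (top ::ₘ Δ)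
  | zeroL (Γ Δ) : Derivable (zero ::ₘ Γ) Δ
  | withL₁ {Γ Δ φ} (ψ) : Derivable (φ ::ₘ Γ) Δ → Derivable (LLFormula.and φ ψ ::ₘ Γ) Δ
  | withL₂ {Γ Δ ψ} (φ) : Derivable (ψ ::ₘ Γ) Δ → Derivable (LLFormula.and φ ψ ::ₘ Γ) Δ
  | withR {Γ Δ φ ψ} :
      Derivable Γ (φ ::ₘ Δ) → Derivable Γ (ψ ::ₘ Δ) → Derivable Γ (LLFormula.and φ ψ ::ₘ Δ)
  | plusL {Γ Δ φ ψ} :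
      Derivable (φ ::ₘ Γ) Δ → Derivable (ψ ::ₘ Γ) Δ → Derivable (plus φ ψ ::ₘ Γ) Δ
  | plusR₁ {Γ Δ φ} (ψ) : Derivable Γ (φ ::ₘ Δ) → Derivable Γ (plus φ ψ ::ₘ Δ)
  | plusR₂ {Γ Δ ψ} (φ) : Derivable Γ (ψ ::ₘ Δ) → Derivable Γ (plus φ ψ ::ₘ Δ)
  | bangDereliction {Γ Δ φ} : Derivable (φ ::ₘ Γ) Δ → Derivable (bang φ ::ₘ Γ) Δ
  | bangWeakening {Γ Δ} (φ) : Derivable Γ Δ → Derivable (bang φ ::ₘ Γ) Δ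
  | bangContraction {Γ Δ φ} :
      Derivable (bang φ ::ₘ bang φ ::ₘ Γ) Δ → Derivable (bang φ ::ₘ Γ) Δ
  | bangPromotion {Γ Δ : Multiset (LLFormula Atom)} {φ} :
      Derivable (Γ.map bang) (φ ::ₘ Δ.map whynot) →
      Derivable (Γ.map bang) (bang φ ::ₘ Δ.map whynot)
  | whynotDereliction {Γ Δ φ} : Derivable Γ (φ ::ₘ Δ) → Derivable Γ (whynot φ ::ₘ Δ)
  | whynotWeakening {Γ Δ} (φ) : Derivable Γ Δ → Derivable Γ (whynot φ ::ₘ Δ)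
  | whynotContraction {Γ Δ φ} :
      Derivable Γ (whynot φ ::ₘ whynot φ ::ₘ Δ) → Derivable Γ (whynot φ ::ₘ Δ)
  | whynotPromotion {Γ Δ : Multiset (LLFormula Atom)} {φ} :
      Derivable (φ ::ₘ Γ.map bang) (Δ.map whynot) →
      Derivable (whynot φ ::ₘ Γ.map bang) (Δ.map whynot)

/-- A formula is provable when the sequent `⊢ φ` is derivable. -/
def Provable {Atom : Type a} (φ : LLFormula Atom) : Prop := Derivable 0 {φ}

end LLFormula

/-! ## Interpretation of formulas in a category -/

/-- The object part of an interpretation of linear logic in a category: one operation for each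
constant and connective. It is only used for the two families of dialectica categories built
below. -/
structure LLInterpretation (D : Type u) where
  neg : D → D
  one : D
  bot : D
  tensor : D → D → D
  par : D → D → D
  top : D
  zero : D
  and : D → D → D
  plus : D → D → D
  bang : D → D
  whynot : D → D

namespace LLInterpretation

variable {D : Type u} (I : LLInterpretation D)

/-- The interpretation of a formula under a valuation of the atoms. -/
def eval {Atom : Type a} (val : Atom → D) : LLFormula Atom → D
  | .atom p => val p
  | .neg φ => I.neg (eval val φ)
  | .one => I.one
  | .bot => I.bot
  | .tensor φ ψ => I.tensor (eval val φ) (eval val ψ)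
  | .par φ ψ => I.par (eval val φ) (eval val ψ)
  | .top => I.top
  | .zero => I.zero
  | .and φ ψ => I.and (eval val φ) (eval val ψ)
  | .plus φ ψ => I.plus (eval val φ) (eval val ψ)
  | .bang φ => I.bang (eval val φ)
  | .whynot φ => I.whynot (eval val φ)

variable [Category.{v} D]

/-- A formula is validated when under every valuation it has a global element `1 ⟶ ⟦φ⟧`. -/
def Validates {Atom : Type a} (φ : LLFormula Atom) : Prop :=
  ∀ val : Atom → D, Nonempty (I.one ⟶ I.eval val φ)

/-- Soundness for classical linear logic with atoms in `Atom`. -/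
def IsSound (Atom : Type a) : Prop :=
  ∀ φ ψ : LLFormula Atom, LLFormula.Derivable {φ} {ψ} →
    ∀ val : Atom → D, Nonempty (I.eval val φ ⟶ I.eval val ψ)

/-- Completeness for classical linear logic with atoms in `Atom`. -/
def IsComplete (Atom : Type a) : Prop :=
  ∀ φ ψ : LLFormula Atom, (∀ val : Atom → D, Nonempty (I.eval val φ ⟶ I.eval val ψ)) →
    LLFormula.Derivable {φ} {ψ}

end LLInterpretation

/-! ## `*`-autonomous categories and linear-nonlinear adjunctions -/

/-- A `*`-autonomous category: a symmetric monoidal closed category with a contravariant functor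
`(-)^⊥`, a natural isomorphism `A^⊥^⊥ ≅ A`, and bijections
`Hom (A ⊗ B, C^⊥) ≃ Hom (A, (B ⊗ C)^⊥)` natural in `A`, `B`, `C`. -/
class StarAutonomous (R : Type u) [Category.{v} R] [MonoidalCategory R] [SymmetricCategory R]
    extends MonoidalClosed R where
  neg : Rᵒᵖ ⥤ R
  negNeg : neg.rightOp ⋙ neg ≅ 𝟭 R
  homEquiv (A B C : R) : (A ⊗ B ⟶ neg.obj (.op C)) ≃ (A ⟶ neg.obj (.op (B ⊗ C)))
  homEquiv_naturality {A A' B B' C C' : R} (f : A' ⟶ A) (g : B' ⟶ B) (h : C' ⟶ C)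
    (k : A ⊗ B ⟶ neg.obj (.op C)) :
    homEquiv A' B' C' ((f ⊗ₘ g) ≫ k ≫ neg.map h.op) =
      f ≫ homEquiv A B C k ≫ neg.map (g ⊗ₘ h).op

namespace StarAutonomous

variable {R : Type u} [Category.{v} R] [MonoidalCategory R] [SymmetricCategory R]
  [StarAutonomous R]

/-- Linear negation on objects. -/
def dual (A : R) : R := (neg (R := R)).obj (.op A)

variable (R) in
/-- The multiplicative falsity `⊥ = 1^⊥`. -/
def bot : R := dual (𝟙_ R)

/-- The multiplicative disjunction `A ⅋ B = (A^⊥ ⊗ B^⊥)^⊥`. -/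
def par (A B : R) : R := dual (dual A ⊗ dual B)

end StarAutonomous

/-- A linear-nonlinear adjunction `L ⊣ M : R → S` between a `*`-autonomous category `R` and a
category `S` with finite products, that is, a model of multiplicative exponential linear logic:
`L` and `M` are lax symmetric monoidal, and so are the unit and the counit. -/
structure LinearNonlinearAdjunction (R : Type u) [Category.{v} R] [MonoidalCategory R]
    [SymmetricCategory R] [StarAutonomous R] (S : Type u') [Category.{v'} S]
    [CartesianMonoidalCategory S] [SymmetricCategory S] where
  L : S ⥤ R
  M : R ⥤ S
  [laxL : L.LaxBraided]
  [laxM : M.LaxBraided]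
  adj : L ⊣ M
  unit_isMonoidal : NatTrans.IsMonoidal adj.unit
  counit_isMonoidal : NatTrans.IsMonoidal adj.counit

namespace LinearNonlinearAdjunction

variable {R : Type u} [Category.{v} R] [MonoidalCategory R] [SymmetricCategory R]
  [StarAutonomous R] {S : Type u'} [Category.{v'} S] [CartesianMonoidalCategory S]
  [SymmetricCategory S] (ℛ : LinearNonlinearAdjunction R S)

/-- The exponential `!A = L (M A)`. -/
def bang (A : R) : R := ℛ.L.obj (ℛ.M.obj A)

/-- The exponential `?A = (!(A^⊥))^⊥`. -/
def whynot (A : R) : R := StarAutonomous.dual (ℛ.bang (StarAutonomous.dual A))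

end LinearNonlinearAdjunction

/-! ## The linear dialectica transformation over sets -/

/-- Objects of the linear dialectica transformation of `R`: families of objects of `R` indexed by
pairs of elements of two sets that are not both empty. -/
structure Dialectica (R : Type u) where
  X : Type w
  Y : Type w
  nonempty : Nonempty X ∨ Nonempty Y
  fam : X → Y → R

namespace Dialectica

section Category

variable {R : Type u} [Category.{v} R]

/-- A morphism `(f, g, α)` of the linear dialectica transformation. -/
@[ext]
structure Hom (G H : Dialectica.{w} R) where
  f : G.X → H.X
  g : H.Y → G.Y
  α : ∀ (x : G.X) (y : H.Y), G.fam x (g y) ⟶ H.fam (f x) y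

instance : Category (Dialectica.{w} R) where
  Hom := Hom
  id G := ⟨id, id, fun _ _ => 𝟙 _⟩
  comp m n := ⟨n.f ∘ m.f, m.g ∘ n.g, fun x y => m.α x (n.g y) ≫ n.α (m.f x) y⟩

end Category

section Additives

variable {R : Type u}

/-- The object `⊤`: one witness and no counter-witness. -/
def top : Dialectica.{w} R := ⟨PUnit, PEmpty, .inl ⟨⟨⟩⟩, fun _ y => y.elim⟩

/-- The object `0`: no witness and one counter-witness. -/
def zero : Dialectica.{w} R := ⟨PEmpty, PUnit, .inr ⟨⟨⟩⟩, fun x _ => x.elim⟩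

/-- Additive conjunction. -/
def and (G H : Dialectica.{w} R) : Dialectica.{w} R where
  X := G.X × H.X
  Y := G.Y ⊕ H.Y
  nonempty := by
    rcases G.nonempty with ⟨⟨x⟩⟩ | ⟨⟨y⟩⟩
    · rcases H.nonempty with ⟨⟨u⟩⟩ | ⟨⟨z⟩⟩
      · exact .inl ⟨(x, u)⟩
      · exact .inr ⟨.inr z⟩
    · exact .inr ⟨.inl y⟩
  fam x z := Sum.elim (G.fam x.1) (H.fam x.2) z

/-- Additive disjunction. -/
def plus (G H : Dialectica.{w} R) : Dialectica.{w} R where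
  X := G.X ⊕ H.X
  Y := G.Y × H.Y
  nonempty := by
    rcases G.nonempty with ⟨⟨x⟩⟩ | ⟨⟨y⟩⟩
    · exact .inl ⟨.inl x⟩
    · rcases H.nonempty with ⟨⟨u⟩⟩ | ⟨⟨z⟩⟩
      · exact .inl ⟨.inr u⟩
      · exact .inr ⟨(y, z)⟩
  fam z y := Sum.elim (fun x => G.fam x y.1) (fun x => H.fam x y.2) z

end Additives

variable {R : Type u} [Category.{v} R] [MonoidalCategory R] [SymmetricCategory R]
  [StarAutonomous R]

/-- The multiplicative unit. -/
def one : Dialectica.{w} R := ⟨PUnit, PUnit, .inl ⟨⟨⟩⟩, fun _ _ => 𝟙_ R⟩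

/-- The multiplicative falsity. -/
def bot : Dialectica.{w} R := ⟨PUnit, PUnit, .inl ⟨⟨⟩⟩, fun _ _ => StarAutonomous.bot R⟩

/-- Linear negation. -/
def neg (G : Dialectica.{w} R) : Dialectica.{w} R :=
  ⟨G.Y, G.X, G.nonempty.symm, fun y x => StarAutonomous.dual (G.fam x y)⟩

/-- Multiplicative conjunction. -/
def tensor (G H : Dialectica.{w} R) : Dialectica.{w} R where
  X := G.X × H.X
  Y := (H.X → G.Y) × (G.X → H.Y)
  nonempty := by
    rcases isEmpty_or_nonempty G.X with hG | hG
    · obtain ⟨y⟩ := G.nonempty.resolve_left (not_nonempty_iff.2 hG)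
      exact .inr ⟨(fun _ => y, fun x => hG.elim x)⟩
    · rcases isEmpty_or_nonempty H.X with hH | hH
      · obtain ⟨y⟩ := H.nonempty.resolve_left (not_nonempty_iff.2 hH)
        exact .inr ⟨(fun x => hH.elim x, fun _ => y)⟩
      · exact .inl inferInstance
  fam x p := G.fam x.1 (p.1 x.2) ⊗ H.fam x.2 (p.2 x.1)

/-- Multiplicative disjunction. -/
def par (G H : Dialectica.{w} R) : Dialectica.{w} R where
  X := (H.Y → G.X) × (G.Y → H.X)
  Y := G.Y × H.Y
  nonempty := (tensor (neg G) (neg H)).nonempty.symm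
  fam p y := StarAutonomous.par (G.fam (p.1 y.2) y.1) (H.fam (p.2 y.1) y.2)

variable {S : Type u'} [Category.{v'} S] [CartesianMonoidalCategory S] [SymmetricCategory S]
  (ℛ : LinearNonlinearAdjunction R S)

/-- The exponential `!`. The fold of `⊗` over a finite multiset is taken along an enumeration of
the multiset; by symmetry its isomorphism class does not depend on the enumeration. -/
noncomputable def bang (G : Dialectica.{w} R) : Dialectica.{w} R where
  X := G.X
  Y := G.X → Multiset G.Y
  nonempty := .inr ⟨fun _ => 0⟩
  fam x f := ((f x).toList.map fun y => ℛ.bang (G.fam x y)).foldr (fun A B => A ⊗ B) (𝟙_ R)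

/-- The exponential `?`. -/
noncomputable def whynot (G : Dialectica.{w} R) : Dialectica.{w} R where
  X := G.Y → Multiset G.X
  Y := G.Y
  nonempty := .inl ⟨fun _ => 0⟩
  fam g y := ((g y).toList.map fun x => ℛ.whynot (G.fam x y)).foldr StarAutonomous.par
    (StarAutonomous.bot R)

/-- The interpretation of linear logic in the dialectica transformation of `ℛ`. -/
noncomputable def interpretation : LLInterpretation (Dialectica.{w} R) where
  neg := neg
  one := one
  bot := bot
  tensor := tensor
  par := par
  top := top
  zero := zero
  and := and
  plus := plus
  bang := bang ℛ
  whynot := whynot ℛ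

end Dialectica

/-! ## Dialectica categories over a cartesian closed base -/

set_option linter.checkUnivs false in
/-- A category indexed over `C` (equivalently, a cloven fibration over `C`): the fibre over `A`
replaces the category of `A`-indexed families of objects of `R`. -/
abbrev IndexedCategory (C : Type u) [Category.{v} C] :=
  Pseudofunctor (LocallyDiscrete Cᵒᵖ) Cat.{v', u'}

namespace IndexedCategory

variable {C : Type u} [Category.{v} C] (E : IndexedCategory.{v, u, v', u'} C)

/-- The fibre over `A`. -/
abbrev Fib (A : C) : Type u' := E.obj ⟨.op A⟩

/-- Reindexing along `h`. -/
abbrev pull {A B : C} (h : A ⟶ B) : E.Fib B ⥤ E.Fib A := (E.map h.op.toLoc).toFunctor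

/-- The canonical isomorphism `(h ≫ k)^* G ≅ h^* (k^* G)`. -/
def pullComp {A B D : C} (h : A ⟶ B) (k : B ⟶ D) (l : A ⟶ D) (e : h ≫ k = l) (G : E.Fib D) :
    (E.pull l).obj G ≅ (E.pull h).obj ((E.pull k).obj G) :=
  (Cat.Hom.toNatIso (E.mapComp' k.op.toLoc h.op.toLoc l.op.toLoc (by subst e; rfl))).app G

/-- Reindexing a morphism `k^* G ⟶ k'^* G'` along `h`, up to the canonical isomorphisms. -/
def res {A B D D' : C} (h : A ⟶ B) {k : B ⟶ D} {k' : B ⟶ D'} {G : E.Fib D} {G' : E.Fib D'}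
    (φ : (E.pull k).obj G ⟶ (E.pull k').obj G') (l : A ⟶ D) (l' : A ⟶ D')
    (e : h ≫ k = l) (e' : h ≫ k' = l') : (E.pull l).obj G ⟶ (E.pull l').obj G' :=
  (E.pullComp h k l e G).hom ≫ (E.pull h).map φ ≫ (E.pullComp h k' l' e' G').inv

theorem res_comp {A B D D' D'' : C} (h : A ⟶ B) {k : B ⟶ D} {k' : B ⟶ D'} {k'' : B ⟶ D''}
    {G : E.Fib D} {G' : E.Fib D'} {G'' : E.Fib D''}
    (φ : (E.pull k).obj G ⟶ (E.pull k').obj G') (ψ : (E.pull k').obj G' ⟶ (E.pull k'').obj G'')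
    (l : A ⟶ D) (l' : A ⟶ D') (l'' : A ⟶ D'')
    (e : h ≫ k = l) (e' : h ≫ k' = l') (e'' : h ≫ k'' = l'') :
    E.res h (φ ≫ ψ) l l'' e e'' = E.res h φ l l' e e' ≫ E.res h ψ l' l'' e' e'' := by
  simp [res]

theorem res_id {A B D : C} (h : A ⟶ B) (k : B ⟶ D) (G : E.Fib D) (l : A ⟶ D) (e : h ≫ k = l) :
    E.res h (𝟙 ((E.pull k).obj G)) l l e e = 𝟙 _ := by
  simp [res]

theorem pullComp_id (B D : C) (k : B ⟶ D) (G : E.Fib D) :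
    (E.pullComp (𝟙 B) k k (by simp) G).hom =
      (E.mapId ⟨.op B⟩).inv.toNatTrans.app ((E.pull k).obj G) := by
  have := E.mapComp'_comp_id_hom k.op.toLoc
  have := congrArg (fun t => t.toNatTrans.app G) this
  simp at this
  exact this

theorem res_one {B D D' : C} {k : B ⟶ D} {k' : B ⟶ D'} {G : E.Fib D} {G' : E.Fib D'}
    (φ : (E.pull k).obj G ⟶ (E.pull k').obj G') :
    E.res (𝟙 B) φ k k' (by simp) (by simp) = φ := by
  rw [res, ← Category.assoc, Iso.comp_inv_eq, pullComp_id, pullComp_id]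
  exact ((E.mapId ⟨.op B⟩).inv.toNatTrans.naturality φ).symm

theorem pullComp_assoc {A B D F : C} (h : A ⟶ B) (k : B ⟶ D) (m : D ⟶ F)
    (hk : A ⟶ D) (km : B ⟶ F) (l : A ⟶ F) (e₁ : h ≫ k = hk) (e₂ : k ≫ m = km) (e₃ : h ≫ km = l)
    (e₄ : hk ≫ m = l) (G : E.Fib F) :
    (E.pullComp h km l e₃ G).hom ≫ (E.pull h).map (E.pullComp k m km e₂ G).hom =
      (E.pullComp hk m l e₄ G).hom ≫ (E.pullComp h k hk e₁ ((E.pull m).obj G)).hom := by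
  have := E.mapComp'₀₂₃_hom_comp_mapComp'_hom_whiskerRight m.op.toLoc k.op.toLoc h.op.toLoc
    km.op.toLoc hk.op.toLoc l.op.toLoc (by subst e₂; rfl) (by subst e₁; rfl) (by subst e₃; rfl)
  have := congrArg (fun t => t.toNatTrans.app G) this
  simpa [pullComp] using this

theorem res_res {A' A B D D' : C} (h' : A' ⟶ A) (h : A ⟶ B) (h'' : A' ⟶ B) {k : B ⟶ D}
    {k' : B ⟶ D'} {G : E.Fib D} {G' : E.Fib D'}
    (φ : (E.pull k).obj G ⟶ (E.pull k').obj G') (l : A ⟶ D) (l' : A ⟶ D') (m : A' ⟶ D)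
    (m' : A' ⟶ D') (e : h ≫ k = l) (e' : h ≫ k' = l') (e₁ : h' ≫ l = m) (e₁' : h' ≫ l' = m')
    (e₂ : h' ≫ h = h'') :
    E.res h' (E.res h φ l l' e e') m m' e₁ e₁' =
      E.res h'' φ m m' (by rw [← e₂, Category.assoc, e, e₁])
        (by rw [← e₂, Category.assoc, e', e₁']) := by
  have nat : (E.pull h'').map φ ≫ (E.pullComp h' h h'' e₂ _).hom =
      (E.pullComp h' h h'' e₂ _).hom ≫ (E.pull h').map ((E.pull h).map φ) :=
    (E.mapComp' h.op.toLoc h'.op.toLoc h''.op.toLoc (by subst e₂; rfl)).hom.toNatTrans.naturality φ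
  have p₁ := E.pullComp_assoc h' h k h'' l m e₂ e e₁ (by rw [← e₂, Category.assoc, e, e₁]) G
  have p₂ := E.pullComp_assoc h' h k' h'' l' m' e₂ e' e₁'
    (by rw [← e₂, Category.assoc, e', e₁']) G'
  unfold res
  rw [← Category.assoc, Iso.comp_inv_eq]
  simp only [Functor.map_comp, Category.assoc]
  rw [reassoc_of% p₁, ← reassoc_of% nat]
  congr 2
  rw [← Iso.inv_comp_eq] at p₂
  rw [← cancel_mono ((E.pull h').map (E.pullComp h k' l' e' G').hom)]
  simp only [Category.assoc]
  rw [← Functor.map_comp, Iso.inv_hom_id, CategoryTheory.Functor.map_id, Category.comp_id, p₂]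

end IndexedCategory

/-- An indexed `*`-autonomous category over `C`: the fibres are `*`-autonomous, the reindexing
functors are strong symmetric monoidal and preserve negation, and the coherence isomorphisms are
monoidal. -/
class IndexedStarAutonomous {C : Type u} [Category.{v} C]
    (E : IndexedCategory.{v, u, v', u'} C) where
  [monoidal (A : C) : MonoidalCategory (E.Fib A)]
  [symmetric (A : C) : SymmetricCategory (E.Fib A)]
  [starAutonomous (A : C) : StarAutonomous (E.Fib A)]
  [braided {A B : C} (h : A ⟶ B) : (E.pull h).Braided]
  pullNeg {A B : C} (h : A ⟶ B) :
    (E.pull h).op ⋙ StarAutonomous.neg ≅ StarAutonomous.neg ⋙ E.pull h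
  mapId_isMonoidal (A : C) : NatTrans.IsMonoidal (F₁ := E.pull (𝟙 A)) (F₂ := 𝟭 (E.Fib A))
    (E.mapId ⟨.op A⟩).hom.toNatTrans
  mapComp_isMonoidal {A B D : C} (h : A ⟶ B) (k : B ⟶ D) :
    NatTrans.IsMonoidal (F₁ := E.pull (h ≫ k)) (F₂ := E.pull k ⋙ E.pull h)
      (E.mapComp k.op.toLoc h.op.toLoc).hom.toNatTrans

attribute [reducible, instance] IndexedStarAutonomous.monoidal IndexedStarAutonomous.symmetric
  IndexedStarAutonomous.starAutonomous IndexedStarAutonomous.braided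

/-- The fibres behave like categories of families with respect to finite coproducts: a family
indexed by an initial object is nothing, and a family indexed by a binary coproduct is a pair of
families. -/
class IndexedCategory.IsExtensive {C : Type u} [Category.{v} C] [HasFiniteCoproducts C]
    (E : IndexedCategory.{v, u, v', u'} C) : Prop where
  initial (A : C) (hA : IsInitial A) : Nonempty (E.Fib A ≌ Discrete PUnit.{1})
  coprod (A B : C) :
    ((E.pull (coprod.inl : A ⟶ A ⨿ B)).prod' (E.pull (coprod.inr : B ⟶ A ⨿ B))).IsEquivalence

attribute [instance] IndexedCategory.IsExtensive.coprod

/-- The family indexed by `A ⨿ B` that is given by two families indexed by `A` and by `B`. -/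
noncomputable def IndexedCategory.copair {C : Type u} [Category.{v} C] [HasFiniteCoproducts C]
    (E : IndexedCategory.{v, u, v', u'} C) [E.IsExtensive] {A B : C} (G : E.Fib A)
    (H : E.Fib B) : E.Fib (A ⨿ B) :=
  ((E.pull (coprod.inl : A ⟶ A ⨿ B)).prod' (E.pull (coprod.inr : B ⟶ A ⨿ B))).inv.obj (G, H)

/-- Objects of the dialectica category of an indexed category `E` over a base with finite
products: objects `X`, `Y` of the base and an object of the fibre over `X × Y`. -/
structure IndexedDialectica {C : Type u} [Category.{v} C] [CartesianMonoidalCategory C]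
    (E : IndexedCategory.{v, u, v', u'} C) where
  X : C
  Y : C
  fam : E.Fib (X ⊗ Y)

namespace IndexedDialectica

section Category

variable {C : Type u} [Category.{v} C] [CartesianMonoidalCategory C]
  {E : IndexedCategory.{v, u, v', u'} C}

/-- A morphism `(f, g, α)`, where `α` is a morphism `G^x_{g v} ⟶ H^{f x}_v` in the fibre over the
product of the object of the `x` and the object of the `v`. -/
structure Hom (G H : IndexedDialectica E) where
  f : G.X ⟶ H.X
  g : H.Y ⟶ G.Y
  α : (E.pull (G.X ◁ g)).obj G.fam ⟶ (E.pull (f ▷ H.Y)).obj H.fam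

theorem Hom.ext' {G H : IndexedDialectica E} {m n : Hom G H} (hf : m.f = n.f) (hg : m.g = n.g)
    (hα : E.res (𝟙 _) m.α (G.X ◁ n.g) (n.f ▷ H.Y) (by rw [hg, Category.id_comp])
      (by rw [hf, Category.id_comp]) = n.α) : m = n := by
  obtain ⟨f, g, α⟩ := m
  obtain ⟨f', g', α'⟩ := n
  obtain rfl : f = f' := hf
  obtain rfl : g = g' := hg
  rw [IndexedCategory.res_one] at hα
  rw [show α = α' from hα]

/-- The identity is `(𝟙, 𝟙, 𝟙)`, up to the canonical isomorphisms. -/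
abbrev Hom.id (G : IndexedDialectica E) : Hom G G :=
  ⟨𝟙 _, 𝟙 _, E.res (𝟙 _) (𝟙 ((E.pull (𝟙 _)).obj G.fam)) _ _ (by simp) (by simp)⟩

/-- Composition is `(f, g, α) ≫ (f', g', β) = (f ≫ f', g' ≫ g, α_{x, g' q} ≫ β_{f x, q})`, up to
the canonical isomorphisms. -/
abbrev Hom.comp {G H K : IndexedDialectica E} (m : Hom G H) (n : Hom H K) : Hom G K :=
  ⟨m.f ≫ n.f, n.g ≫ m.g,
    E.res (G.X ◁ n.g) m.α _ (m.f ⊗ₘ n.g) (by simp) (by rw [MonoidalCategory.tensorHom_def']) ≫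
      E.res (m.f ▷ K.Y) n.α (m.f ⊗ₘ n.g) _ (by rw [MonoidalCategory.tensorHom_def]) (by simp)⟩

instance : Category (IndexedDialectica E) where
  Hom := Hom
  id := Hom.id
  comp := Hom.comp
  id_comp {G H} m := by
    refine Hom.ext' (Category.id_comp _) (Category.comp_id _) ?_
    change E.res _ (E.res (G.X ◁ m.g) (E.res _ _ _ _ _ _) _ (𝟙 G.X ⊗ₘ m.g) _ _ ≫
      E.res (𝟙 G.X ▷ H.Y) m.α _ _ _ _) _ _ _ _ = m.α
    rw [E.res_res _ _ (G.X ◁ m.g) _ _ _ _ _ _ _ _ _ (by simp),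
      E.res_comp (l' := G.X ◁ m.g) (e' := by simp), E.res_res _ _ (G.X ◁ m.g) (e₂ := by simp),
      E.res_id, Category.id_comp, E.res_res _ _ (𝟙 _) (e₂ := by simp), E.res_one]
  comp_id {G H} m := by
    refine Hom.ext' (Category.comp_id _) (Category.id_comp _) ?_
    change E.res _ (E.res (G.X ◁ 𝟙 H.Y) m.α _ (m.f ⊗ₘ 𝟙 H.Y) _ _ ≫
      E.res (m.f ▷ H.Y) (E.res _ _ _ _ _ _) _ _ _ _) _ _ _ _ = m.α
    rw [E.res_res _ _ (m.f ▷ H.Y) _ _ _ _ _ _ _ _ _ (by simp),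
      E.res_comp (l' := m.f ▷ H.Y) (e' := by simp), E.res_res _ _ (𝟙 _) (e₂ := by simp),
      E.res_one, E.res_res _ _ (m.f ▷ H.Y) (e₂ := by simp), E.res_id, Category.comp_id]
  assoc {G H K L} m n p := by
    refine Hom.ext' (Category.assoc _ _ _) (Category.assoc _ _ _).symm ?_
    change E.res _ (E.res (G.X ◁ p.g) (E.res (G.X ◁ n.g) m.α _ _ _ _ ≫
        E.res (m.f ▷ K.Y) n.α _ _ _ _) _ ((m.f ≫ n.f) ⊗ₘ p.g) _ _ ≫
          E.res ((m.f ≫ n.f) ▷ L.Y) p.α _ _ _ _) _ _ _ _ =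
      E.res (G.X ◁ (p.g ≫ n.g)) m.α _ (m.f ⊗ₘ (p.g ≫ n.g)) _ _ ≫
        E.res (m.f ▷ L.Y) (E.res (H.X ◁ p.g) n.α _ _ _ _ ≫ E.res (n.f ▷ L.Y) p.α _ _ _ _) _ _ _ _
    have e₁ : G.X ◁ p.g ≫ (m.f ⊗ₘ n.g) = m.f ⊗ₘ (p.g ≫ n.g) := by
      simp [MonoidalCategory.tensorHom_def']
    have e₂ : m.f ▷ L.Y ≫ (n.f ⊗ₘ p.g) = (m.f ≫ n.f) ⊗ₘ p.g := by
      simp [MonoidalCategory.tensorHom_def]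
    have e₃ : G.X ◁ p.g ≫ m.f ▷ K.Y = m.f ⊗ₘ p.g := by rw [MonoidalCategory.tensorHom_def']
    have e₄ : m.f ▷ L.Y ≫ H.X ◁ p.g = m.f ⊗ₘ p.g := by rw [MonoidalCategory.tensorHom_def]
    rw [E.res_comp (G.X ◁ p.g) _ _ _ _ _ _ e₁, E.res_comp (m.f ▷ L.Y) _ _ _ _ _ _ e₂,
      E.res_res _ _ _ (e₂ := e₃), E.res_res _ _ _ (e₂ := e₄),
      E.res_res _ _ (G.X ◁ (p.g ≫ n.g)) (e₂ := by simp),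
      E.res_res _ _ ((m.f ≫ n.f) ▷ L.Y) (e₂ := by simp),
      E.res_comp (l' := (m.f ≫ n.f) ⊗ₘ p.g) (e' := by simp),
      E.res_comp (l' := m.f ⊗ₘ (p.g ≫ n.g)) (e' := by simp),
      E.res_res _ _ _ (e₂ := Category.id_comp _), E.res_res _ _ _ (e₂ := Category.id_comp _),
      E.res_res _ _ _ (e₂ := Category.id_comp _), Category.assoc]

end Category

variable {C : Type u} [Category.{v} C] [CartesianMonoidalCategory C]
  {E : IndexedCategory.{v, u, v', u'} C} [IndexedStarAutonomous E]

/-- The multiplicative unit. -/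
def one : IndexedDialectica E := ⟨𝟙_ C, 𝟙_ C, 𝟙_ _⟩

/-- The multiplicative falsity. -/
def bot : IndexedDialectica E := ⟨𝟙_ C, 𝟙_ C, StarAutonomous.bot _⟩

/-- Linear negation. -/
def neg (G : IndexedDialectica E) : IndexedDialectica E :=
  ⟨G.Y, G.X, StarAutonomous.dual ((E.pull (lift (snd G.Y G.X) (fst G.Y G.X))).obj G.fam)⟩

section Closed

variable [MonoidalClosed C]

/-- Multiplicative conjunction: the fibre over `(x, u, f, g)` is `G^x_{f u} ⊗ H^u_{g x}`. -/
def tensor (G H : IndexedDialectica E) : IndexedDialectica E where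
  X := G.X ⊗ H.X
  Y := (ihom H.X).obj G.Y ⊗ (ihom G.X).obj H.Y
  fam :=
    (E.pull (lift (fst _ _ ≫ fst _ _)
      (lift (fst _ _ ≫ snd _ _) (snd _ _ ≫ fst _ _) ≫ (ihom.ev H.X).app G.Y))).obj G.fam ⊗
    (E.pull (lift (fst _ _ ≫ snd _ _)
      (lift (fst _ _ ≫ fst _ _) (snd _ _ ≫ snd _ _) ≫ (ihom.ev G.X).app H.Y))).obj H.fam

/-- Multiplicative disjunction: the fibre over `(f, g, y, v)` is `G^{f v}_y ⅋ H^{g y}_v`. -/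
def par (G H : IndexedDialectica E) : IndexedDialectica E where
  X := (ihom H.Y).obj G.X ⊗ (ihom G.Y).obj H.X
  Y := G.Y ⊗ H.Y
  fam := StarAutonomous.par
    ((E.pull (lift
      (lift (snd _ _ ≫ snd _ _) (fst _ _ ≫ fst _ _) ≫ (ihom.ev H.Y).app G.X)
      (snd _ _ ≫ fst _ _))).obj G.fam)
    ((E.pull (lift
      (lift (snd _ _ ≫ fst _ _) (fst _ _ ≫ snd _ _) ≫ (ihom.ev G.Y).app H.X)
      (snd _ _ ≫ snd _ _))).obj H.fam)

end Closed

section Additives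

variable [HasFiniteCoproducts C]

/-- The object `⊤`, with `X` terminal and `Y` initial. In an extensive indexed category over a
cartesian closed base all objects of the fibre over `X × Y` are isomorphic. -/
noncomputable def top : IndexedDialectica E := ⟨𝟙_ C, ⊥_ C, 𝟙_ _⟩

/-- The object `0`, with `X` initial and `Y` terminal. -/
noncomputable def zero : IndexedDialectica E := ⟨⊥_ C, 𝟙_ C, 𝟙_ _⟩

variable [MonoidalClosed C]

/-- The distributivity morphism `A × (B + D) ⟶ A × B + A × D`. -/
noncomputable def distrib (A B D : C) : A ⊗ (B ⨿ D) ⟶ (A ⊗ B) ⨿ (A ⊗ D) :=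
  MonoidalClosed.uncurry
    (coprod.desc (MonoidalClosed.curry coprod.inl) (MonoidalClosed.curry coprod.inr))

variable [E.IsExtensive]

/-- Additive conjunction: the fibre over `(x, u, z)` is `G^x_z` for `z` in `Y`, and `H^u_z` for `z`
in `V`. -/
noncomputable def and (G H : IndexedDialectica E) : IndexedDialectica E where
  X := G.X ⊗ H.X
  Y := G.Y ⨿ H.Y
  fam := (E.pull (distrib (G.X ⊗ H.X) G.Y H.Y)).obj (E.copair
    ((E.pull (lift (fst _ _ ≫ fst _ _) (snd _ _))).obj G.fam)
    ((E.pull (lift (fst _ _ ≫ snd _ _) (snd _ _))).obj H.fam))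

/-- Additive disjunction: the fibre over `(z, y, v)` is `G^z_y` for `z` in `X`, and `H^z_v` for `z`
in `U`. -/
noncomputable def plus (G H : IndexedDialectica E) : IndexedDialectica E where
  X := G.X ⨿ H.X
  Y := G.Y ⊗ H.Y
  fam := (E.pull (lift (snd _ _) (fst _ _) ≫ distrib (G.Y ⊗ H.Y) G.X H.X)).obj (E.copair
    ((E.pull (lift (snd _ _) (fst _ _ ≫ fst _ _))).obj G.fam)
    ((E.pull (lift (snd _ _) (fst _ _ ≫ snd _ _))).obj H.fam))

variable (bang : IndexedDialectica E → IndexedDialectica E)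

/-- The interpretation of linear logic in the dialectica category of `E`, for a given
interpretation of the exponential `!` on objects. -/
noncomputable def interpretation : LLInterpretation (IndexedDialectica E) where
  neg := neg
  one := one
  bot := bot
  tensor := tensor
  par := par
  top := top
  zero := zero
  and := and
  plus := plus
  bang := bang
  whynot G := neg (bang (neg G))

end Additives

end IndexedDialectica

/-! ## The two-valued model of linear logic -/

/-! A counter-witness of `G ⊗ H` contains a function from the witnesses of `G` to the
counter-witnesses of `H`. Since `⊥` has a witness and `⊤` has no counter-witness, `⊥ ⊗ ⊤` has no
counter-witness either (`isEmpty_tensor_top_Y`). Its family is therefore indexed by the empty set,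
the value `⊥` of `R` is never consulted, and only the single witness remains, as in `⊤`. Hence `⊥ ⊗
⊤ ≅ ⊤`, and the map `1 ⟶ ⊤` validates the formula.

Linear logic does not prove it: collapsing multiplicatives onto additives and erasing the
exponentials turns every derivation into a valid classical inference (`Derivable.classicallyTrue`),
while `⊥ ⊗ ⊤` becomes "false and true". So completeness fails on its own, whether or not the
interpretation is sound.

Over a cartesian closed base, two facts replace the emptiness argument. Initial objects are strict,
so evaluation at the point of `1` shows the object of counter-witnesses to be initial
(`isInitialTensorBotTop`). A fibre over an initial object is trivial, so a morphism into an object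
with initial `Y` is the same as its witness part (`exists_hom_of_isInitial`,
`hom_ext_of_isInitial`). -/

namespace LLFormula

/-- The classical truth value of a formula, with all atoms false, the multiplicatives and the
additives identified, and trivial exponentials. -/
def ClassicallyTrue {Atom : Type a} : LLFormula Atom → Prop
  | .atom _ => False
  | .neg φ => ¬ ClassicallyTrue φ
  | .one => True
  | .bot => False
  | .tensor φ ψ => ClassicallyTrue φ ∧ ClassicallyTrue ψ
  | .par φ ψ => ClassicallyTrue φ ∨ ClassicallyTrue ψ
  | .top => True
  | .zero => False
  | .and φ ψ => ClassicallyTrue φ ∧ ClassicallyTrue ψ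
  | .plus φ ψ => ClassicallyTrue φ ∨ ClassicallyTrue ψ
  | .bang φ => ClassicallyTrue φ
  | .whynot φ => ClassicallyTrue φ

/-- Linear logic is sound for two-valued classical semantics. -/
theorem Derivable.classicallyTrue {Atom : Type a} {Γ Δ : Multiset (LLFormula Atom)}
    (h : Derivable Γ Δ) :
    (∀ φ ∈ Γ, φ.ClassicallyTrue) → ∃ ψ ∈ Δ, ψ.ClassicallyTrue := by
  -- After unfolding, each rule is a classical tautology about its principal formulas. Promotion
  -- leaves the contexts unchanged and only adds a modality, which does not alter truth values.
  induction h <;>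
    simp only [Multiset.mem_cons, Multiset.mem_add, Multiset.mem_singleton, or_imp,
      forall_and, or_and_right, exists_or, ClassicallyTrue, exists_eq_left, forall_eq,
      Multiset.notMem_zero] at * <;>
    grind

/-- Completeness concerns sequents with one formula on each side. This is the instance it would
yield; its antecedent is classically true and its succedent false. -/
theorem not_derivable_one_tensor_bot_top {Atom : Type a} :
    ¬ Derivable {(one : LLFormula Atom)} {tensor bot top} := fun h => by
  simpa [ClassicallyTrue] using h.classicallyTrue

theorem not_provable_tensor_bot_top {Atom : Type a} :
    ¬ (tensor bot top : LLFormula Atom).Provable := fun h => by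
  simpa [ClassicallyTrue] using Derivable.classicallyTrue h

end LLFormula

/-- Being validated is, by unfolding `eval` at `one`, exactly the premise of completeness for the
sequent `1 ⊢ ⊥ ⊗ ⊤`. -/
theorem LLInterpretation.Validates.not_isComplete {D : Type u} [Category.{v} D]
    {I : LLInterpretation D} {Atom : Type a}
    (h : I.Validates (LLFormula.tensor .bot .top : LLFormula Atom)) : ¬ I.IsComplete Atom :=
  fun hc => LLFormula.not_derivable_one_tensor_bot_top (hc .one _ h)

/-! ## Dialectica categories over sets -/

namespace Dialectica

/-- The second component of a counter-witness is a map from the one-point set of witnesses of `⊥` to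
the empty set. -/
instance isEmpty_tensor_top_Y {R : Type u} [Category.{v} R] [MonoidalCategory R]
    [SymmetricCategory R] [StarAutonomous R] :
    IsEmpty (tensor.{w} (R := R) bot top).Y :=
  ⟨fun p => (p.2 ⟨⟩).elim⟩

/-- In the dialectica transformation, `⊥ ⊗ ⊤` is isomorphic to `⊤`. -/
def tensorBotTopIso {R : Type u} [Category.{v} R] [MonoidalCategory R]
    [SymmetricCategory R] [StarAutonomous R] :
    tensor.{w} (R := R) bot top ≅ top where
  hom := ⟨fun _ => ⟨⟩, PEmpty.elim, fun _ y => y.elim⟩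
  inv := ⟨fun _ => (⟨⟩, ⟨⟩), isEmptyElim, fun _ y => isEmptyElim y⟩
  -- The type of `α` depends on `f` and `g`, so extensionality asks for a heterogeneous equality; it
  -- is vacuous because no counter-witness exists.
  hom_inv_id := Hom.ext rfl (funext fun y => isEmptyElim y)
    (Function.hfunext rfl fun _ _ _ => Function.hfunext rfl fun y => isEmptyElim y)
  inv_hom_id := Hom.ext rfl (funext fun y => y.elim)
    (Function.hfunext rfl fun _ _ _ => Function.hfunext rfl fun y => y.elim)

/-- The morphism `1 ⟶ ⊤`. -/
def oneToTop {R : Type u} [Category.{v} R] [MonoidalCategory R]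
    [SymmetricCategory R] [StarAutonomous R] : one.{w} (R := R) ⟶ top :=
  ⟨fun _ => ⟨⟩, PEmpty.elim, fun _ y => y.elim⟩

/-- The formula contains no atoms, so one morphism serves all valuations. -/
theorem validates_tensor_bot_top {R : Type u} [Category.{v} R] [MonoidalCategory R]
    [SymmetricCategory R] [StarAutonomous R] {S : Type u'} [Category.{v'} S]
    [CartesianMonoidalCategory S] [SymmetricCategory S] (ℛ : LinearNonlinearAdjunction R S)
    (Atom : Type a) :
    (interpretation.{w} ℛ).Validates (LLFormula.tensor .bot .top : LLFormula Atom) :=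
  fun _ => ⟨oneToTop ≫ tensorBotTopIso.inv⟩

end Dialectica

/-! ## Dialectica categories over a cartesian closed base -/

section StrictInitial

variable {C : Type u} [Category.{v} C] [CartesianMonoidalCategory C] [MonoidalClosed C]

/-- In a cartesian closed category, a product whose second factor is initial is initial. -/
noncomputable def isInitialTensor (A : C) {B : C} (hB : IsInitial B) : IsInitial (A ⊗ B) :=
  -- By closedness, `A ⊗ -` is a left adjoint and so preserves initial objects.
  hB.isInitialObj (tensorLeft A)

/-- In a cartesian closed category, an object with a morphism to an initial object is initial. -/
noncomputable def isInitialOfHom {A B : C} (hB : IsInitial B) (t : A ⟶ B) : IsInitial A :=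
  -- The graph of `t` makes `A` a retract of `A ⊗ B`, which is initial; this forces `t` to be
  -- invertible.
  have := strict_initial hB t
  hB.ofIso (asIso t).symm

end StrictInitial

/-! ### Triviality of the fibres over initial objects -/

section ExtensiveFibre

variable {C : Type u} [Category.{v} C] [HasFiniteCoproducts C]
  (E : IndexedCategory.{v, u, v', u'} C) [E.IsExtensive]

/-- In the fibre over an initial object, there is exactly one morphism between any two objects. -/
theorem IndexedCategory.IsExtensive.nonempty_unique_hom {A : C} (hA : IsInitial A)
    (G H : E.Fib A) : Nonempty (Unique (G ⟶ H)) := by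
  obtain ⟨e⟩ := IndexedCategory.IsExtensive.initial (E := E) A hA
  -- The hom-set is in bijection with one of the terminal category, where all objects are equal and
  -- parallel morphisms agree.
  have e' := e.fullyFaithfulFunctor.homEquiv (X := G) (Y := H)
  exact ⟨⟨⟨e'.symm (eqToHom (Subsingleton.elim _ _))⟩, fun _ => e'.injective
    (Subsingleton.elim _ _)⟩⟩

end ExtensiveFibre

/-! ### Objects whose counter-witnesses form an initial object -/

namespace IndexedDialectica

variable {C : Type u} [Category.{v} C] [CartesianMonoidalCategory C] [MonoidalClosed C]
  [HasFiniteCoproducts C] {E : IndexedCategory.{v, u, v', u'} C}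

section

variable [E.IsExtensive]

/-- A morphism into an object whose `Y` is initial amounts to a morphism of the base. -/
theorem exists_hom_of_isInitial {G H : IndexedDialectica E} (hH : IsInitial H.Y)
    (f : G.X ⟶ H.X) : ∃ m : G ⟶ H, Hom.f m = f := by
  -- The component `α` lives over `G.X ⊗ H.Y`, which is initial together with `H.Y`, so it exists
  -- whatever the two families are.
  obtain ⟨i⟩ := IndexedCategory.IsExtensive.nonempty_unique_hom E (isInitialTensor G.X hH)
    ((E.pull (G.X ◁ hH.to G.Y)).obj G.fam) ((E.pull (f ▷ H.Y)).obj H.fam)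
  exact ⟨(⟨f, hH.to G.Y, i.default⟩ : Hom G H), rfl⟩

/-- The component `g` starts at an initial object and `α` lies in a trivial fibre, so neither
carries information beyond `f`. -/
theorem hom_ext_of_isInitial {G H : IndexedDialectica E} (hH : IsInitial H.Y)
    {m n : G ⟶ H} (h : Hom.f m = Hom.f n) : m = n := by
  obtain ⟨i⟩ := IndexedCategory.IsExtensive.nonempty_unique_hom E (isInitialTensor G.X hH)
    ((E.pull (G.X ◁ Hom.g n)).obj G.fam) ((E.pull (Hom.f n ▷ H.Y)).obj H.fam)
  exact Hom.ext' h (hH.hom_ext _ _) ((i.uniq _).trans (i.uniq _).symm)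

/-- Objects whose `Y` is initial and whose `X` are isomorphic are isomorphic. -/
theorem nonempty_iso_of_isInitial {G H : IndexedDialectica E} (hG : IsInitial G.Y)
    (hH : IsInitial H.Y) (e : G.X ≅ H.X) : Nonempty (G ≅ H) := by
  obtain ⟨m, hm⟩ := exists_hom_of_isInitial hH e.hom
  obtain ⟨n, hn⟩ := exists_hom_of_isInitial hG e.inv
  refine ⟨⟨m, n, hom_ext_of_isInitial hG ?_, hom_ext_of_isInitial hH ?_⟩⟩
  · change Hom.f m ≫ Hom.f n = 𝟙 _
    rw [hm, hn, e.hom_inv_id]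
  · change Hom.f n ≫ Hom.f m = 𝟙 _
    rw [hm, hn, e.inv_hom_id]

end

variable [IndexedStarAutonomous E]

/-- The counter-witnesses of `⊥ ⊗ ⊤` form an initial object. -/
noncomputable def isInitialTensorBotTop : IsInitial (tensor (E := E) bot top).Y :=
  -- By strictness a morphism to `⊥_ C` suffices: project to the exponential from `𝟙_ C` to `⊥_ C`
  -- and evaluate at the unique point of `𝟙_ C`.
  isInitialOfHom (initialIsInitial (C := C))
    (snd _ _ ≫ lift (toUnit _) (𝟙 _) ≫ (ihom.ev (𝟙_ C)).app (⊥_ C))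

variable [E.IsExtensive]

/-- In the dialectica category of `E`, `⊥ ⊗ ⊤` is isomorphic to `⊤`. -/
theorem nonempty_tensor_bot_top_iso : Nonempty (tensor (E := E) bot top ≅ top) :=
  nonempty_iso_of_isInitial isInitialTensorBotTop initialIsInitial (λ_ (𝟙_ C))

/-- The formula contains neither atoms nor exponentials, so the valuation and `bang` play no role.
The only datum to supply is the point of `𝟙_ C ⊗ 𝟙_ C`. -/
theorem validates_tensor_bot_top (bang : IndexedDialectica E → IndexedDialectica E)
    (Atom : Type a) :
    (interpretation bang).Validates (LLFormula.tensor .bot .top : LLFormula Atom) := fun _ =>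
  ⟨(exists_hom_of_isInitial (G := one) (H := tensor bot top) isInitialTensorBotTop
    (λ_ (𝟙_ C)).inv).choose⟩

end IndexedDialectica

/-! ### Incompleteness of both kinds of dialectica category -/

theorem mainTheorem9 (Atom : Type a) :
    -- `⊥ ⊗ ⊤` is not provable in classical linear logic
    ¬ (LLFormula.tensor .bot .top : LLFormula Atom).Provable ∧
    -- dialectica transformations, over sets, of models of multiplicative exponential linear logic
    (∀ (R : Type u) [Category.{v} R] [MonoidalCategory R] [SymmetricCategory R]
        [StarAutonomous R] (S : Type u') [Category.{v'} S] [CartesianMonoidalCategory S]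
        [SymmetricCategory S] (ℛ : LinearNonlinearAdjunction R S),
      Nonempty (Dialectica.tensor.{w} (R := R) Dialectica.bot Dialectica.top ≅ Dialectica.top) ∧
      (Dialectica.interpretation.{w} ℛ).Validates
        (LLFormula.tensor .bot .top : LLFormula Atom) ∧
      ¬ (Dialectica.interpretation.{w} ℛ).IsComplete Atom ∧
      ¬ ((Dialectica.interpretation.{w} ℛ).IsSound Atom ∧
        (Dialectica.interpretation.{w} ℛ).IsComplete Atom)) ∧
    -- dialectica categories over an arbitrary cartesian closed base, with any interpretation of `!`
    (∀ (C : Type u) [Category.{v} C] [CartesianMonoidalCategory C] [MonoidalClosed C]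
        [HasFiniteCoproducts C] (E : IndexedCategory.{v, u, v', u'} C) [IndexedStarAutonomous E]
        [E.IsExtensive] (bang : IndexedDialectica E → IndexedDialectica E),
      Nonempty (IndexedDialectica.tensor (E := E) IndexedDialectica.bot IndexedDialectica.top ≅
        IndexedDialectica.top) ∧
      (IndexedDialectica.interpretation bang).Validates
        (LLFormula.tensor .bot .top : LLFormula Atom) ∧
      ¬ (IndexedDialectica.interpretation bang).IsComplete Atom ∧
      ¬ ((IndexedDialectica.interpretation bang).IsSound Atom ∧
        (IndexedDialectica.interpretation bang).IsComplete Atom)) := by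
  refine ⟨LLFormula.not_provable_tensor_bot_top, ?_, ?_⟩
  · intro R _ _ _ _ S _ _ _ ℛ
    have hv := Dialectica.validates_tensor_bot_top.{w} ℛ Atom
    exact ⟨⟨Dialectica.tensorBotTopIso⟩, hv, hv.not_isComplete, fun h => hv.not_isComplete h.2⟩
  · intro C _ _ _ _ E _ _ bang
    have hv := IndexedDialectica.validates_tensor_bot_top bang Atom
    exact ⟨IndexedDialectica.nonempty_tensor_bot_top_iso, hv, hv.not_isComplete,
      fun h => hv.not_isComplete h.2⟩
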